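/- Let $\mathcal F$ be a filter on $\omega$, i.e. a family of infinite subsets of $\omega$ that contains all cofinite sets and is closed under finite intersections and supersets. Let $[\omega]^{<\omega}$ denote the countable set of all nonempty finite subsets of $\omega$, and let $\mathcal F^{<\omega}$ be the filter on $[\omega]^{<\omega}$ consisting of all $\mathcal A\subseteq[\omega]^{<\omega}$ that contain $\{a\in[\omega]^{<\omega}: a\subseteq F\}$ for some $F\in\mathcal F$. Then the following are equivalent: 1. the Mathias forcing $\mathbb M_{\mathcal F}$ does not add dominating reals; 2. $\mathcal F$ is Menger; 3. $\mathcal F^{<\omega}$ is Menger; 4. $\mathcal F^{<\omega}$ is a $P^+$-filter; 5. $\mathcal F$ is a strong $P^+$-filter; 6. $\mathcal F^{<\omega}$ is a strong $P^+$-filter (where $[\omega]^{<\omega}$ is identified with $\omega$ by an arbitrary fixed bijection). Here $\mathbb M_{\mathcal F}$ consists of the pairs $\langle s,F\rangle$ with $s$ a finite (possibly empty) subset of $\omega$, $F\in\mathcal F$ and $\max s<\min F$ (no requirement if $s=\emptyset$), where $\langle s,F\rangle\le\langle t,G\rangle$ ($\langle s,F\rangle$ is stronger) iff $F\subseteq G$,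 $s$ is an end-extension of $t$ and $s\setminus t\subseteq G$. A forcing adds no dominating reals if no condition $p$ and no name $\dot x$ for an element of $\omega^\omega$ satisfy $p\Vdash$ "for every $a\in\omega^\omega$ of the ground model, $a(n)\le\dot x(n)$ for all but finitely many $n$". A topological space $X$ is Menger if for every sequence $(\mathcal U_n)_{n\in\omega}$ of open covers of $X$ there are finite $\mathcal V_n\subseteq\mathcal U_n$ such that $\bigcup_n\mathcal V_n$ covers $X$; a filter on a countable set $S$ is regarded as a subspace of $\mathcal P(S)=2^S$ with the product topology. For a filter $\mathcal G$ on a countable set $S$, $\mathcal G^+$ is the family of all $A\subseteq S$ with $S\setminus A\notin\mathcal G$. $\mathcal G$ is a $P^+$-filter if for every decreasing sequence $(X_n)_{n\in\omega}$ in $\mathcal G^+$ there is $X\in\mathcal G^+$ with $X\setminus X_n$ finite for all $n$. A filter $\mathcal G$ on $\omega$ is a strong $P^+$-filter if for every sequence $(\mathcal C_n)_{n\in\omega}$ of compact subsets of $\mathcal P(\omega)$ with $\mathcal C_n\subseteq\mathcal G^+$ there is a strictly increasing sequence $(k_n)_{n\in\omega}$ of natural numbers such that $\bigcup_n\bigl(X_n\cap[k_n,k_{n+1})\bigr)\in\mathcal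 G^+$ whenever $X_n\in\mathcal C_n$ for all $n$. -/

import Mathlib

namespace FilterForcing

/-! ### Names for reals and the forcing relation -/

section Forcing

variable {P : Type*} [Preorder P]

/-- Two conditions are compatible if they have a common extension (`r ≤ p` means that `r` is
stronger than `p`). -/
def Compatible (p q : P) : Prop := ∃ r : P, r ≤ p ∧ r ≤ q

/-- A (nice) `P`-name for an element of `ω^ω`: the name whose elements are the pairs
`((n, k)ˇ, p)` with `p ∈ val n k`, where the trivial condition forces this set of pairs to be a
function (`functional`) that is defined on all of `ω` (`total`). -/
structure RealName (P : Type*) [Preorder P] where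
  val : ℕ → ℕ → Set P
  functional : ∀ (n k l : ℕ) (p q : P), p ∈ val n k → q ∈ val n l → Compatible p q → k = l
  total : ∀ (n : ℕ) (p : P), ∃ k : ℕ, ∃ q ∈ val n k, Compatible p q

/-- The clause of the forcing relation for existential quantifiers: `p` forces that some `i` in
the ground model set `s` satisfies `φ i` iff the conditions forcing an instance are dense below
`p`. -/
def ForcesExists {ι : Type*} (s : Set ι) (φ : ι → P → Prop) (p : P) : Prop :=
  ∀ q ≤ p, ∃ r ≤ q, ∃ i ∈ s, φ i r

/-- `p ⊩ x(n) = k`, that is, `p` forces the pair `(n, k)` to belong to the name `x`. -/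
def RealName.ForcesEq (x : RealName P) (n k : ℕ) (p : P) : Prop :=
  ForcesExists (x.val n k) (fun c r => r ≤ c) p

/-- `p ⊩ a ≤* x`, that is, `p ⊩ ∃ m, ∀ n ≥ m, ∃ k ≥ a(n), x(n) = k`, for a ground model
function `a`. -/
def RealName.ForcesDominates (x : RealName P) (a : ℕ → ℕ) (p : P) : Prop :=
  ForcesExists Set.univ
    (fun m q => ∀ n ≥ m, ForcesExists {k | a n ≤ k} (fun k r => x.ForcesEq n k r) q) p

/-- `p` forces `x` to be a dominating real: `p ⊩ a ≤* x` for every `a ∈ ω^ω` of the ground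
model. -/
def RealName.ForcesDominating (x : RealName P) (p : P) : Prop :=
  ∀ a : ℕ → ℕ, x.ForcesDominates a p

/-- `P` does not add dominating reals: no condition forces a name to be a dominating real. -/
def AddsNoDominatingReal (P : Type*) [Preorder P] : Prop :=
  ∀ (x : RealName P) (p : P), ¬ x.ForcesDominating p

end Forcing

/-! ### Mathias forcing associated with a filter -/

/-- Conditions `⟨s, A⟩` of the Mathias forcing associated with `F`: `s` is a finite subset of
`ω`, `A ∈ F`, and `max s < min A`. -/
structure Mathias (F : Filter ℕ) where
  stem : Finset ℕ
  side : Set ℕ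
  side_mem : side ∈ F
  stem_lt_side : ∀ i ∈ stem, ∀ j ∈ side, i < j

/-- `⟨s, A⟩ ≤ ⟨t, B⟩` iff `A ⊆ B`, `s` is an end-extension of `t`, and `s \ t ⊆ B`. -/
instance Mathias.instPreorder (F : Filter ℕ) : Preorder (Mathias F) where
  le p q := p.side ⊆ q.side ∧
    (q.stem ⊆ p.stem ∧ ∀ i ∈ q.stem, ∀ j ∈ p.stem \ q.stem, i < j) ∧
    ((p.stem \ q.stem : Finset ℕ) : Set ℕ) ⊆ q.side
  le_refl p := by simp
  le_trans p q r := by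
    rintro ⟨h1, ⟨h2, h3⟩, h4⟩ ⟨k1, ⟨k2, k3⟩, k4⟩
    refine ⟨h1.trans k1, ⟨k2.trans h2, ?_⟩, ?_⟩
    · intro i hi j hj
      rw [Finset.mem_sdiff] at hj
      by_cases hq : j ∈ q.stem
      · exact k3 i hi j (Finset.mem_sdiff.2 ⟨hq, hj.2⟩)
      · exact h3 i (k2 hi) j (Finset.mem_sdiff.2 ⟨hj.1, hq⟩)
    · intro j hj
      rw [Finset.mem_coe, Finset.mem_sdiff] at hj
      by_cases hq : j ∈ q.stem
      · exact k4 (Finset.mem_coe.2 (Finset.mem_sdiff.2 ⟨hq, hj.2⟩))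
      · exact k1 (h4 (Finset.mem_coe.2 (Finset.mem_sdiff.2 ⟨hj.1, hq⟩)))

/-! ### The Menger property -/

/-- The Menger covering property of a topological space. -/
def MengerSpace (X : Type*) [TopologicalSpace X] : Prop :=
  ∀ U : ℕ → Set (Set X),
    (∀ n, (∀ u ∈ U n, IsOpen u) ∧ ⋃₀ (U n) = Set.univ) →
      ∃ V : ℕ → Set (Set X),
        (∀ n, V n ⊆ U n ∧ (V n).Finite) ∧ (⋃ n, ⋃₀ (V n)) = Set.univ

/-- The subset of `S` with characteristic function `x`. -/
def toSet {S : Type*} (x : S → Bool) : Set S := {s | x s = true}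

/-- A family of subsets of `S` as a subspace of the Cantor space `2^S` (with the product
topology), via characteristic functions. -/
def cantorSubspace {S : Type*} (𝒳 : Set (Set S)) : Set (S → Bool) := {x | toSet x ∈ 𝒳}

/-- A filter is Menger if it is a Menger subspace of the power set. -/
def IsMenger {S : Type*} (F : Filter S) : Prop := MengerSpace (cantorSubspace F.sets)

/-! ### `P⁺`-filters and strong `P⁺`-filters -/

/-- The family `F⁺` of `F`-positive sets: those not in the dual ideal. -/
def positive {S : Type*} (F : Filter S) : Set (Set S) := {A | Aᶜ ∉ F}

/-- `F` is a `P⁺`-filter: every decreasing sequence of positive sets has a positive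
pseudo-intersection. -/
def IsPPlus {S : Type*} (F : Filter S) : Prop :=
  ∀ X : ℕ → Set S, Antitone X → (∀ n, X n ∈ positive F) →
    ∃ Y ∈ positive F, ∀ n, (Y \ X n).Finite

/-- `F` is a strong `P⁺`-filter: for every sequence of compact sets `C n ⊆ F⁺` there is an
increasing sequence `k` of integers such that `⋃ n, X n ∩ [k n, k (n + 1))` is positive whenever
`X n ∈ C n` for all `n`. -/
def IsStrongPPlus (F : Filter ℕ) : Prop :=
  ∀ C : ℕ → Set (ℕ → Bool), (∀ n, IsCompact (C n) ∧ C n ⊆ cantorSubspace (positive F)) →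
    ∃ k : ℕ → ℕ, StrictMono k ∧
      ∀ X : ℕ → ℕ → Bool, (∀ n, X n ∈ C n) →
        (⋃ n, toSet (X n) ∩ Set.Ico (k n) (k (n + 1))) ∈ positive F

/-! ### The filter `F^{<ω}` -/

/-- The countable set of nonempty finite subsets of `ω`. -/
abbrev NeFin : Type := {a : Finset ℕ // a.Nonempty}

/-- The filter `F^{<ω}` generated by the sets of all (nonempty) finite subsets of `A`,
for `A ∈ F`. -/
def finPow (F : Filter ℕ) : Filter NeFin where
  sets := {𝒜 | ∃ A ∈ F, {a : NeFin | (a.1 : Set ℕ) ⊆ A} ⊆ 𝒜}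
  univ_sets := ⟨Set.univ, Filter.univ_mem, Set.subset_univ _⟩
  sets_of_superset := by
    rintro x y ⟨A, hA, h⟩ hxy
    exact ⟨A, hA, h.trans hxy⟩
  inter_sets := by
    rintro x y ⟨A, hA, h⟩ ⟨B, hB, k⟩
    exact ⟨A ∩ B, Filter.inter_mem hA hB, fun a ha =>
      ⟨h (ha.trans Set.inter_subset_left), k (ha.trans Set.inter_subset_right)⟩⟩

end FilterForcing

/-!
All six properties say that finite selections suffice for one kind of family: the families `𝒜` of
finite sets such that every member of `F` contains an element of `𝒜` (`FinPositive`).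

* Menger: such a family is a cover of `F` by basic clopen sets. As the set of all supersets of a
  member of `F` is a compact subset of `F`, every open cover is refined by a cover of this kind up
  to taking finite unions.
* Passing from `F` to `F^{<ω}` does not change the principle, as finite families of finite sets may
  be replaced by their unions.
* `P⁺` for `F^{<ω}`: these families are the `F^{<ω}`-positive sets, and a pseudo-intersection of a
  decreasing sequence amounts to a finite selection from it.
* Strong `P⁺`: the sets meeting every element of such a family form a compact set of positive sets,
  and by compactness the finite sets meeting every member of a compact set of positive sets form
  such a family.
* Dominating reals: if selection fails for `(𝒜 n)`, then the least `k` such that the generic real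
  contains an element of `𝒜 n` inside `[n, k)` is, as a function of `n`, dominating. Conversely,
  given a name `x`, the finite sets that contain, for each stem `s ⊆ [0, n)`, an extension of `s`
  deciding `x(n)` form such a family; a finite selection leaves finitely many decided values, and
  `x` is infinitely often below a bound for these.
-/

namespace FilterForcing

open Filter Set TopologicalSpace

section Selection

variable {α β : Type*} {P : Set α → Prop}

/-- The selection principle `S_fin(P, P)` for a property `P` of families. -/
def FiniteSelection (P : Set α → Prop) : Prop :=
  ∀ 𝒜 : ℕ → Set α, (∀ n, P (𝒜 n)) →
    ∃ ℬ : ℕ → Finset α, (∀ n, ↑(ℬ n) ⊆ 𝒜 n) ∧ P (⋃ n, ↑(ℬ n))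

theorem FiniteSelection.of_image {Q : Set β → Prop} (φ : α → β) (hφ : ∀ 𝒜, P 𝒜 ↔ Q (φ '' 𝒜))
    (hQ : FiniteSelection Q) : FiniteSelection P := by
  classical
  intro 𝒜 h𝒜
  obtain ⟨ℬ, hℬ, hQℬ⟩ := hQ (fun n => φ '' 𝒜 n) fun n => (hφ _).1 (h𝒜 n)
  choose 𝒞 h𝒞 h𝒞ℬ using fun n => Finset.subset_set_image_iff.1 (hℬ n)
  refine ⟨𝒞, h𝒞, (hφ _).2 ?_⟩
  simpa only [image_iUnion, ← Finset.coe_image, h𝒞ℬ] using hQℬ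

/-- Applying the principle to every tail of the sequence makes every tail of the selection
good. -/
theorem FiniteSelection.exists_forall_tail (h : FiniteSelection P) (hP : Monotone P)
    {𝒜 : ℕ → Set α} (h𝒜 : ∀ n, P (𝒜 n)) :
    ∃ ℬ : ℕ → Finset α, (∀ n, ↑(ℬ n) ⊆ 𝒜 n) ∧ ∀ N, P (⋃ n ≥ N, ↑(ℬ n)) := by
  classical
  choose ℬ hℬ hPℬ using fun N => h (fun n => 𝒜 (N + n)) fun n => h𝒜 (N + n)
  refine ⟨fun n => (Finset.range (n + 1)).biUnion fun N => ℬ N (n - N), fun n => ?_,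
    fun N => hP (iUnion_subset fun n => ?_) (hPℬ N)⟩
  · rw [Finset.coe_biUnion]
    refine iUnion₂_subset fun N hN => ?_
    have hNn : N + (n - N) = n := by have := Finset.mem_range.1 hN; lia
    simpa only [hNn] using hℬ N (n - N)
  · refine Subset.trans ?_ (subset_iUnion₂ (N + n) (Nat.le_add_right N n))
    have hN : N ∈ Finset.range (N + n + 1) := Finset.mem_range.2 (by lia)
    simpa only [Nat.add_sub_cancel_left] using Finset.coe_subset.2
      (Finset.subset_biUnion_of_mem (fun M => ℬ M (N + n - M)) hN)

theorem mengerSpace_iff {X : Type*} [TopologicalSpace X] :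
    MengerSpace X ↔ FiniteSelection fun 𝒰 : Set (Opens X) => sSup 𝒰 = ⊤ := by
  classical
  have hcover (𝒰 : Set (Opens X)) : sSup 𝒰 = ⊤ ↔ ⋃₀ ((↑) '' 𝒰 : Set (Set X)) = univ := by
    rw [← Opens.coe_eq_univ, Opens.coe_sSup, sUnion_image]
  simp only [FiniteSelection, hcover]
  constructor
  · intro h 𝒰 h𝒰
    obtain ⟨V, hV, hVcov⟩ := h (fun n => (↑) '' 𝒰 n) fun n =>
      ⟨forall_mem_image.2 fun u _ => u.isOpen, h𝒰 n⟩
    choose W hW hWV using fun n => Finset.subset_set_image_iff.1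
      ((hV n).2.coe_toFinset.symm ▸ (hV n).1)
    refine ⟨W, hW, ?_⟩
    simpa only [image_iUnion, ← Finset.coe_image, hWV, Finite.coe_toFinset, sUnion_iUnion]
      using hVcov
  · intro h U hU
    have himage (n) : ((↑) '' ((↑) ⁻¹' U n : Set (Opens X)) : Set (Set X)) = U n :=
      image_preimage_eq_of_subset fun u hu => ⟨⟨u, (hU n).1 u hu⟩, rfl⟩
    obtain ⟨V, hV, hVcov⟩ := h (fun n => (↑) ⁻¹' U n) fun n => by rw [himage, (hU n).2]
    refine ⟨fun n => (↑) '' (V n : Set (Opens X)), fun n =>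
      ⟨image_subset_iff.2 (hV n), (V n).finite_toSet.image _⟩, ?_⟩
    rwa [image_iUnion, sUnion_iUnion] at hVcov

end Selection

section FinPositive

variable {S T : Type*} {F : Filter S} {G : Filter T} {𝒜 : Set (Finset S)}

/-- Every member of `F` contains a member of `𝒜`: the family `𝒜` is positive for the filter of
finite sets induced by `F`. In contrast to `finPow`, the empty set is allowed as a member
of `𝒜`. -/
def FinPositive (F : Filter S) (𝒜 : Set (Finset S)) : Prop :=
  ∀ A ∈ F, ∃ a ∈ 𝒜, (a : Set S) ⊆ A

theorem monotone_finPositive : Monotone (FinPositive F) :=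
  fun _ _ hsub h A hA => (h A hA).imp fun _ ha => ⟨hsub ha.1, ha.2⟩

theorem FinPositive.sep_subset (h : FinPositive F 𝒜) {A : Set S} (hA : A ∈ F) :
    FinPositive F {a ∈ 𝒜 | ↑a ⊆ A} := by
  intro B hB
  obtain ⟨a, ha, haAB⟩ := h _ (inter_mem hA hB)
  exact ⟨a, ⟨ha, haAB.trans inter_subset_left⟩, haAB.trans inter_subset_right⟩

theorem FinPositive.forall_exists_subset {ι : Type*} (I : Finset ι) {𝒜 : ι → Set (Finset S)}
    (h : ∀ i ∈ I, FinPositive F (𝒜 i)) :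
    FinPositive F {b | ∀ i ∈ I, ∃ a ∈ 𝒜 i, a ⊆ b} := by
  classical
  intro A hA
  choose! a ha haA using fun i hi => h i hi A hA
  refine ⟨I.biUnion a, fun i hi => ⟨a i, ha i hi, Finset.subset_biUnion_of_mem a hi⟩, ?_⟩
  rw [Finset.coe_biUnion]
  exact iUnion₂_subset haA

theorem finPositive_image_iff {φ : Finset S → Finset T}
    (hF : ∀ A ∈ F, ∃ B ∈ G, ∀ a, (φ a : Set T) ⊆ B → (a : Set S) ⊆ A)
    (hG : ∀ B ∈ G, ∃ A ∈ F, ∀ a : Finset S, (a : Set S) ⊆ A → (φ a : Set T) ⊆ B) :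
    FinPositive F 𝒜 ↔ FinPositive G (φ '' 𝒜) := by
  constructor
  · intro h B hB
    obtain ⟨A, hA, hAB⟩ := hG B hB
    obtain ⟨a, ha, haA⟩ := h A hA
    exact ⟨φ a, mem_image_of_mem φ ha, hAB a haA⟩
  · intro h A hA
    obtain ⟨B, hB, hBA⟩ := hF A hA
    obtain ⟨_, ⟨a, ha, rfl⟩, haB⟩ := h B hB
    exact ⟨a, ha, hBA a haB⟩

/-- The Menger property restricted to covers by the basic clopen sets `{A | a ⊆ A}` with `a`
finite. -/
def FinMenger (F : Filter S) : Prop :=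
  FiniteSelection (FinPositive F)

theorem FinMenger.of_map_equiv (e : S ≃ T) (h : FinMenger (F.map e)) : FinMenger F :=
  FiniteSelection.of_image (Finset.map e.toEmbedding) (fun _ => finPositive_image_iff
    (fun A hA => ⟨e '' A, image_mem_map hA, fun a ha => by simpa using ha⟩)
    (fun B hB => ⟨e ⁻¹' B, hB, fun a ha => by simpa using ha⟩)) h

theorem finMenger_map_equiv (e : S ≃ T) : FinMenger (F.map e) ↔ FinMenger F :=
  ⟨.of_map_equiv e, fun h => .of_map_equiv e.symm <| by simpa [map_map] using h⟩

end FinPositive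

section Menger

variable {S : Type*} {F : Filter S} {A : Set S}

/-- The compact set of all supersets of `A`, as a subset of the Cantor space `2^S`. -/
def upperCone (A : Set S) : Set (S → Bool) :=
  A.pi fun _ => {true}

theorem isCompact_upperCone (A : Set S) : IsCompact (upperCone A) :=
  (isClosed_set_pi fun _ _ => isClosed_discrete _).isCompact

theorem isOpen_upperCone (a : Finset S) : IsOpen (upperCone (a : Set S)) :=
  isOpen_set_pi a.finite_toSet fun _ _ => isOpen_discrete _

theorem isOpen_eval_eq (i : S) (b : Bool) : IsOpen {x : S → Bool | x i = b} :=
  (continuous_apply (A := fun _ : S => Bool) i).isOpen_preimage {b} (isOpen_discrete _)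

theorem upperCone_subset_cantorSubspace (hA : A ∈ F) : upperCone A ⊆ cantorSubspace F.sets :=
  fun _ hx => mem_of_superset hA hx

theorem exists_finset_upperCone_subset {O : Set (S → Bool)} (hO : IsOpen O)
    (hAO : upperCone A ⊆ O) : ∃ a : Finset S, ↑a ⊆ A ∧ upperCone (a : Set S) ⊆ O := by
  have hcover : Oᶜ ⊆ ⋃ i ∈ A, {x : S → Bool | x i = false} := by
    refine compl_subset_comm.1 fun x hx => hAO fun i hi => ?_
    simpa using fun h => hx (mem_iUnion₂.2 ⟨i, hi, h⟩)
  obtain ⟨b, hbA, hb, hbcover⟩ := hO.isClosed_compl.isCompact.elim_finite_subcover_image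
    (fun i _ => isOpen_eval_eq i false) hcover
  lift b to Finset S using hb
  refine ⟨b, hbA, fun x hx => not_not.1 fun hxO => ?_⟩
  obtain ⟨i, hi, hxi⟩ := mem_iUnion₂.1 (hbcover hxO)
  exact Bool.false_ne_true (hxi.symm.trans (hx i hi))

/-- The basic open set `{A ∈ F | a ⊆ A}` of the filter `F`. -/
def basicOpen (F : Filter S) (a : Finset S) : Opens (cantorSubspace F.sets) :=
  ⟨Subtype.val ⁻¹' upperCone (a : Set S), (isOpen_upperCone a).preimage continuous_subtype_val⟩

theorem finPositive_iff_sSup_basicOpen {𝒜 : Set (Finset S)} :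
    FinPositive F 𝒜 ↔ sSup (basicOpen F '' 𝒜) = ⊤ := by
  classical
  simp only [eq_top_iff, SetLike.le_def, Opens.mem_sSup, exists_mem_image]
  constructor
  · exact fun h x _ => h _ x.2
  · intro h A hA
    have hx : (fun i => decide (i ∈ A)) ∈ cantorSubspace F.sets := by
      simpa [cantorSubspace, toSet] using hA
    obtain ⟨a, ha, haA⟩ := h (Opens.mem_top ⟨_, hx⟩)
    exact ⟨a, ha, fun i hi => by simpa using haA i hi⟩

/-- The cone above a member of `F` is a compact subset of `F`, so finitely many members of a
cover suffice for it, and hence for a neighbourhood. -/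
theorem finPositive_setOf_basicOpen_le {𝒰 : Set (Opens (cantorSubspace F.sets))}
    (h𝒰 : sSup 𝒰 = ⊤) :
    FinPositive F
      {a | ∃ 𝒱 : Finset (Opens (cantorSubspace F.sets)), ↑𝒱 ⊆ 𝒰 ∧ basicOpen F a ≤ sSup 𝒱} := by
  intro A hA
  have hcompact : IsCompact (Subtype.val ⁻¹' upperCone A : Set (cantorSubspace F.sets)) :=
    (Topology.IsInducing.subtypeVal.isCompact_preimage_iff
      (by simpa using upperCone_subset_cantorSubspace hA)).2 (isCompact_upperCone A)
  obtain ⟨𝒱, h𝒱𝒰, h𝒱fin, h𝒱⟩ := hcompact.elim_finite_subcover_image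
    (b := 𝒰) (c := (↑)) (fun u _ => u.isOpen) (by rw [← Opens.coe_sSup, h𝒰]; exact subset_univ _)
  lift 𝒱 to Finset (Opens (cantorSubspace F.sets)) using h𝒱fin
  rw [← Opens.coe_sSup] at h𝒱
  obtain ⟨O, hO, hO𝒱⟩ := isOpen_induced_iff.1
    (sSup (𝒱 : Set (Opens (cantorSubspace F.sets)))).isOpen
  rw [← hO𝒱] at h𝒱
  obtain ⟨a, haA, haO⟩ := exists_finset_upperCone_subset hO fun x hx =>
    h𝒱 (show (⟨x, upperCone_subset_cantorSubspace hA hx⟩ : cantorSubspace F.sets) ∈ _ from hx)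
  exact ⟨a, ⟨𝒱, h𝒱𝒰, fun x hx => hO𝒱.subset (haO hx)⟩, haA⟩

theorem FinMenger.isMenger (h : FinMenger F) : IsMenger F := by
  classical
  refine mengerSpace_iff.2 fun 𝒰 h𝒰 => ?_
  obtain ⟨ℬ, hℬ, hpos⟩ := h _ fun n => finPositive_setOf_basicOpen_le (h𝒰 n)
  choose 𝒱 h𝒱𝒰 h𝒱 using fun n (a : ℬ n) => hℬ n a.2
  refine ⟨fun n => Finset.univ.biUnion (𝒱 n), fun n => ?_, ?_⟩
  · simpa using h𝒱𝒰 n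
  · rw [finPositive_iff_sSup_basicOpen] at hpos
    rw [eq_top_iff, ← hpos]
    refine sSup_le <| forall_mem_image.2 fun a ha => ?_
    obtain ⟨n, ha⟩ := mem_iUnion.1 ha
    refine (h𝒱 n ⟨a, ha⟩).trans (sSup_le_sSup (Subset.trans ?_ (subset_iUnion _ n)))
    exact Finset.coe_subset.2 (Finset.subset_biUnion_of_mem (𝒱 n) (Finset.mem_univ _))

theorem isMenger_iff_finMenger : IsMenger F ↔ FinMenger F :=
  ⟨fun h => (mengerSpace_iff.1 h).of_image (basicOpen F) fun _ => finPositive_iff_sSup_basicOpen,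
    FinMenger.isMenger⟩

end Menger

section PPlus

variable {S : Type*} {G : Filter S} {X : ℕ → Set S}

theorem mem_positive_iff {Y : Set S} : Y ∈ positive G ↔ ∀ A ∈ G, ∃ i ∈ A, i ∈ Y :=
  frequently_iff

theorem inter_mem_positive {Y A : Set S} (hY : Y ∈ positive G) (hA : A ∈ G) :
    Y ∩ A ∈ positive G :=
  Frequently.and_eventually hY hA

theorem FiniteSelection.isPPlus (h : FiniteSelection (· ∈ positive G)) : IsPPlus G := by
  intro X hX hpos
  obtain ⟨ℬ, hℬ, hℬpos⟩ := h X hpos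
  refine ⟨_, hℬpos, fun n => ?_⟩
  refine ((finite_lt_nat n).biUnion fun m _ => (ℬ m).finite_toSet).subset ?_
  rintro i ⟨hi, hin⟩
  obtain ⟨m, him⟩ := mem_iUnion.1 hi
  have hmn : m < n := not_le.1 fun hnm => hin (hX hnm (hℬ m him))
  exact mem_iUnion₂.2 ⟨m, hmn, him⟩

/-- From a positive pseudo-intersection `Y`, select at stage `n` the points of `Y` leaving the
sequence after `X n`, and the `n`-th point of `S`, in order to exhaust `Y ∩ ⋂ n, X n`. -/
theorem IsPPlus.exists_finset [Countable S] (hcof : G ≤ cofinite) (h : IsPPlus G)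
    (hX : Antitone X) (hpos : ∀ n, X n ∈ positive G) :
    ∃ ℬ : ℕ → Finset S, (∀ n, ↑(ℬ n) ⊆ X n) ∧ (⋃ n, ↑(ℬ n)) ∈ positive G := by
  obtain ⟨index, hindex⟩ := exists_injective_nat S
  obtain ⟨Y, hY, hYfin⟩ := h X hX hpos
  let Z (n : ℕ) : Set S := X n ∩ (Y \ X (n + 1) ∪ index ⁻¹' {n})
  have hZ (n) : (Z n).Finite :=
    ((hYfin _).union ((finite_singleton n).preimage hindex.injOn)).subset inter_subset_right
  refine ⟨fun n => (hZ n).toFinset, fun n => by simp [Z], ?_⟩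
  have hY₀ : Y ∩ (Y \ X 0)ᶜ ∈ positive G :=
    inter_mem_positive hY (hcof (hYfin 0).compl_mem_cofinite)
  refine Frequently.mono hY₀ fun i ⟨hiY, hi₀⟩ => not_not.1 fun hi => ?_
  simp only [Finite.coe_toFinset, mem_iUnion, not_exists] at hi
  have hiX (n) : i ∈ X n := by
    induction n with
    | zero => exact not_not.1 fun hin => hi₀ ⟨hiY, hin⟩
    | succ n ih => exact not_not.1 fun hin => hi n ⟨ih, Or.inl ⟨hiY, hin⟩⟩
  exact hi (index i) ⟨hiX _, Or.inr rfl⟩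

end PPlus

section FinPow

variable {F : Filter ℕ}

theorem finPow_le_cofinite (hcof : F ≤ cofinite) : finPow F ≤ cofinite := by
  rw [le_cofinite_iff_compl_singleton_mem] at hcof ⊢
  rintro ⟨a, i, hi⟩
  refine ⟨{i}ᶜ, hcof i, fun b hb hba => ?_⟩
  exact hb (show i ∈ b.1 from hba ▸ hi) rfl

theorem map_finPow_le_cofinite (hcof : F ≤ cofinite) (e : NeFin ≃ ℕ) :
    (finPow F).map e ≤ cofinite :=
  (map_mono (finPow_le_cofinite hcof)).trans e.injective.tendsto_cofinite

theorem setOf_subset_mem_finPow {A : Set ℕ} (hA : A ∈ F) :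
    {a : NeFin | (a.1 : Set ℕ) ⊆ A} ∈ finPow F :=
  ⟨A, hA, Subset.rfl⟩

/-- The embedding `i ↦ {i}` of `ω` into its nonempty finite subsets. -/
def NeFin.singletonEmbedding : ℕ ↪ NeFin :=
  ⟨fun i => ⟨{i}, Finset.singleton_nonempty i⟩, fun i j hij => by simpa using hij⟩

theorem NeFin.coe_singletonEmbedding_subset_iff {i : ℕ} {A : Set ℕ} :
    ((singletonEmbedding i).1 : Set ℕ) ⊆ A ↔ i ∈ A := by
  rw [show (singletonEmbedding i).1 = {i} from rfl, Finset.coe_singleton, singleton_subset_iff]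

theorem finMenger_finPow : FinMenger (finPow F) ↔ FinMenger F := by
  classical
  constructor
  · refine FiniteSelection.of_image (Finset.map NeFin.singletonEmbedding) fun _ =>
      finPositive_image_iff (fun A hA => ⟨_, setOf_subset_mem_finPow hA, fun a ha i hi => ?_⟩) ?_
    · exact NeFin.coe_singletonEmbedding_subset_iff.1
        (ha (Finset.mem_coe.2 (Finset.mem_map_of_mem _ hi)))
    · rintro 𝒳 ⟨A, hA, hA𝒳⟩
      refine ⟨A, hA, fun a ha => Subset.trans ?_ hA𝒳⟩
      rw [Finset.coe_map, image_subset_iff]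
      exact fun i hi => NeFin.coe_singletonEmbedding_subset_iff.2 (ha hi)
  · refine FiniteSelection.of_image (Finset.biUnion · Subtype.val) fun _ =>
      finPositive_image_iff ?_ fun A hA => ⟨_, setOf_subset_mem_finPow hA, fun a ha => ?_⟩
    · rintro 𝒳 ⟨A, hA, hA𝒳⟩
      refine ⟨A, hA, fun a ha b hb => hA𝒳 (Subset.trans ?_ ha)⟩
      exact Finset.coe_subset.2 (Finset.subset_biUnion_of_mem Subtype.val hb)
    · rw [Finset.coe_biUnion]
      exact iUnion₂_subset ha

theorem mem_positive_finPow {𝒳 : Set NeFin} :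
    𝒳 ∈ positive (finPow F) ↔ FinPositive F (Subtype.val '' 𝒳) := by
  simp only [mem_positive_iff, FinPositive, exists_mem_image]
  constructor
  · intro h A hA
    obtain ⟨a, haA, ha⟩ := h _ (setOf_subset_mem_finPow hA)
    exact ⟨a, ha, haA⟩
  · rintro h 𝒴 ⟨A, hA, hA𝒴⟩
    obtain ⟨a, ha, haA⟩ := h A hA
    exact ⟨a, hA𝒴 haA, ha⟩

theorem FinMenger.isPPlus_finPow (h : FinMenger F) : IsPPlus (finPow F) :=
  (FiniteSelection.of_image Subtype.val (fun _ => mem_positive_finPow) h).isPPlus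

theorem FinPositive.preimage_mem_positive_finPow [F.NeBot] {𝒜 : Set (Finset ℕ)}
    (h : FinPositive F 𝒜) (hup : IsUpperSet 𝒜) :
    (Subtype.val ⁻¹' 𝒜 : Set NeFin) ∈ positive (finPow F) := by
  classical
  refine mem_positive_finPow.2 fun A hA => ?_
  obtain ⟨a, ha, haA⟩ := h A hA
  obtain ⟨i, hi⟩ := Filter.nonempty_of_mem hA
  refine ⟨insert i a, ⟨⟨insert i a, Finset.insert_nonempty i a⟩,
    hup (Finset.subset_insert i a) ha, rfl⟩, ?_⟩
  rw [Finset.coe_insert]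
  exact insert_subset hi haA

theorem IsPPlus.finMenger [F.NeBot] (hcof : F ≤ cofinite) (h : IsPPlus (finPow F)) :
    FinMenger F := by
  classical
  intro 𝒜 h𝒜
  let 𝒟 (n : ℕ) : Set (Finset ℕ) := {b | ∀ i ∈ Finset.range (n + 1), ∃ a ∈ 𝒜 i, a ⊆ b}
  have h𝒟 : Antitone 𝒟 := fun m n hmn b hb i hi => hb i (Finset.range_mono (by lia) hi)
  have h𝒟up (n) : IsUpperSet (𝒟 n) := fun b c hbc hb i hi =>
    (hb i hi).imp fun _ ha => ⟨ha.1, ha.2.trans hbc⟩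
  obtain ⟨ℬ, hℬ, hpos⟩ := h.exists_finset (finPow_le_cofinite hcof)
    (X := fun n => Subtype.val ⁻¹' 𝒟 n) (fun m n hmn => preimage_mono (h𝒟 hmn)) fun n =>
      (FinPositive.forall_exists_subset _ fun i _ => h𝒜 i).preimage_mem_positive_finPow (h𝒟up n)
  refine ⟨fun n => {a ∈ (ℬ n).biUnion fun b => b.1.powerset | a ∈ 𝒜 n}, fun n a ha =>
    (Finset.mem_filter.1 ha).2, fun A hA => ?_⟩
  obtain ⟨_, ⟨b, hb, rfl⟩, hbA⟩ := mem_positive_finPow.1 hpos A hA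
  obtain ⟨n, hb⟩ := mem_iUnion.1 hb
  obtain ⟨a, ha, hab⟩ := hℬ n hb n (Finset.self_mem_range_succ n)
  refine ⟨a, mem_iUnion.2 ⟨n, ?_⟩, (Finset.coe_subset.2 hab).trans hbA⟩
  exact Finset.mem_filter.2 ⟨Finset.mem_biUnion.2 ⟨b, hb, Finset.mem_powerset.2 hab⟩, ha⟩

theorem isPPlus_finPow_iff_finMenger [F.NeBot] (hcof : F ≤ cofinite) :
    IsPPlus (finPow F) ↔ FinMenger F :=
  ⟨IsPPlus.finMenger hcof, FinMenger.isPPlus_finPow⟩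

end FinPow

section Transversals

variable {S : Type*} {F : Filter S}

/-- The points of the Cantor space that represent sets meeting every member of `𝒜`. -/
def transversals (𝒜 : Set (Finset S)) : Set (S → Bool) :=
  {x | ∀ a ∈ 𝒜, ∃ i ∈ a, i ∈ toSet x}

theorem isCompact_transversals (𝒜 : Set (Finset S)) : IsCompact (transversals 𝒜) := by
  have hinter : transversals 𝒜 = ⋂ a ∈ 𝒜, ⋃ i ∈ a, {x | x i = true} := by
    ext x
    simp [transversals, toSet]
  rw [hinter]
  exact (isClosed_biInter fun a _ => a.finite_toSet.isClosed_biUnion fun i _ =>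
    isClosed_eq (continuous_apply i) continuous_const).isCompact

theorem FinPositive.transversals_subset {𝒜 : Set (Finset S)} (h : FinPositive F 𝒜) :
    transversals 𝒜 ⊆ cantorSubspace (positive F) := by
  refine fun x hx => mem_positive_iff.2 fun A hA => ?_
  obtain ⟨a, ha, haA⟩ := h A hA
  obtain ⟨i, hi, hix⟩ := hx a ha
  exact ⟨i, haA hi, hix⟩

theorem finPositive_of_isCompact {C : Set (S → Bool)} (hC : IsCompact C)
    (hCpos : C ⊆ cantorSubspace (positive F)) :
    FinPositive F {a | ∀ x ∈ C, ∃ i ∈ a, i ∈ toSet x} := by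
  intro A hA
  obtain ⟨b, hbA, hb, hcover⟩ := hC.elim_finite_subcover_image
    (fun i _ => isOpen_eval_eq i true) fun x hx => mem_iUnion₂.2 <| by
      simpa [toSet] using mem_positive_iff.1 (hCpos hx) A hA
  lift b to Finset S using hb
  exact ⟨b, fun x hx => by simpa [toSet] using hcover hx, hbA⟩

end Transversals

section StrongPPlus

variable {F : Filter ℕ}

theorem IsStrongPPlus.finMenger (h : IsStrongPPlus F) : FinMenger F := by
  classical
  intro 𝒜 h𝒜
  obtain ⟨k, -, hk⟩ := h (fun n => transversals (𝒜 n)) fun n =>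
    ⟨isCompact_transversals _, (h𝒜 n).transversals_subset⟩
  refine ⟨fun n => {a ∈ (Finset.range (k (n + 1))).powerset | a ∈ 𝒜 n}, fun n a ha =>
    (Finset.mem_filter.1 ha).2, fun A hA => ?_⟩
  by_contra! hno
  -- Otherwise the sets `Aᶜ ∪ [k (n + 1), ∞)` are transversals, and `Aᶜ` contains the positive
  -- set obtained from them.
  have hX (n) : (fun i => decide (i ∉ A ∨ k (n + 1) ≤ i)) ∈ transversals (𝒜 n) := by
    intro a ha
    by_contra! hX
    have haA : ∀ i ∈ a, i ∈ A ∧ i < k (n + 1) := by simpa [toSet] using hX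
    refine hno a (mem_iUnion.2 ⟨n, Finset.mem_filter.2 ⟨?_, ha⟩⟩) fun i hi => (haA i hi).1
    exact Finset.mem_powerset.2 fun i hi => Finset.mem_range.2 (haA i hi).2
  obtain ⟨i, hiA, hi⟩ := mem_positive_iff.1 (hk _ hX) A hA
  obtain ⟨n, hin, -, hlt⟩ := mem_iUnion.1 hi
  have : i ∉ A ∨ k (n + 1) ≤ i := by simpa [toSet] using hin
  exact this.elim (· hiA) hlt.not_ge

theorem exists_strictMono_forall_le_succ (g : ℕ → ℕ) :
    ∃ k : ℕ → ℕ, k 0 = 0 ∧ StrictMono k ∧ ∀ i, ∀ n ≤ k i, g n ≤ k (i + 1) := by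
  let next (m : ℕ) : ℕ := m + 1 + (Finset.range (m + 1)).sup g
  have hsucc (i) : next^[i + 1] 0 = next (next^[i] 0) := Function.iterate_succ_apply' ..
  refine ⟨fun i => next^[i] 0, rfl, strictMono_nat_of_lt_succ fun i => ?_, fun i n hn => ?_⟩
  · exact (Nat.lt_of_succ_le (Nat.le_add_right _ _)).trans_eq (hsucc i).symm
  · refine le_of_le_of_eq ?_ (hsucc i).symm
    exact (Finset.le_sup (Finset.mem_range_succ_iff.2 hn)).trans (Nat.le_add_left _ _)

theorem exists_mem_Ico_of_strictMono {k : ℕ → ℕ} (hk : StrictMono k) (hk₀ : k 0 = 0) (n : ℕ) :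
    ∃ i, n ∈ Ico (k i) (k (i + 1)) := by
  have hIco := iUnion_Ico_map_succ_eq_Ici (f := k) (fun i => hk.monotone bot_le)
    hk.not_bddAbove_range_of_wellFoundedLT
  exact mem_iUnion.1 (hIco.symm.subset (hk₀.trans_le n.zero_le : k 0 ≤ n))

theorem Ici_mem_of_le_cofinite (hcof : F ≤ cofinite) (n : ℕ) : Ici n ∈ F :=
  hcof (Nat.cofinite_eq_atTop ▸ Ici_mem_atTop n)

theorem FinMenger.exists_overlapping_intervals (hcof : F ≤ cofinite) (h : FinMenger F)
    {𝒜 : ℕ → Set (Finset ℕ)} (h𝒜 : ∀ n, FinPositive F (𝒜 n)) :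
    ∃ k : ℕ → ℕ, StrictMono k ∧
      ∀ A ∈ F, ∃ i, ∀ j ≤ i, ∃ a ∈ 𝒜 j, (a : Set ℕ) ⊆ A ∩ Ico (k i) (k (i + 2)) := by
  classical
  obtain ⟨ℬ, hℬ, hpos⟩ := h _ fun n => FinPositive.forall_exists_subset (Finset.range (n + 1))
    fun i _ => (h𝒜 i).sep_subset (Ici_mem_of_le_cofinite hcof n)
  choose g hg using fun n => ((ℬ n).biUnion id).exists_nat_subset_range
  obtain ⟨k, hk₀, hk, hgk⟩ := exists_strictMono_forall_le_succ g
  refine ⟨k, hk, fun A hA => ?_⟩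
  obtain ⟨b, hb, hbA⟩ := hpos A hA
  obtain ⟨n, hb⟩ := mem_iUnion.1 hb
  obtain ⟨i, hi, hi'⟩ := exists_mem_Ico_of_strictMono hk hk₀ n
  refine ⟨i, fun j hj => ?_⟩
  have hjn : j ≤ n := hj.trans (hk.le_apply.trans hi)
  obtain ⟨a, ⟨ha, han⟩, hab⟩ := hℬ n hb j (Finset.mem_range_succ_iff.2 hjn)
  refine ⟨a, ha, fun l hl => ⟨hbA (hab hl), hi.trans (han hl), ?_⟩⟩
  have hlg : l < g n :=
    Finset.mem_range.1 (hg n (Finset.mem_biUnion.2 ⟨b, hb, hab hl⟩))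
  exact hlg.trans_le (hgk (i + 1) n hi'.le)

/-- The overlapping intervals `[k i, k (i + 2))` split into those with `i` even and those with `i`
odd, each consecutive; as `F` is closed under intersections, one of the two kinds works for all
of `F`. -/
theorem FinMenger.exists_intervals (hcof : F ≤ cofinite) (h : FinMenger F)
    {𝒜 : ℕ → Set (Finset ℕ)} (h𝒜 : ∀ n, FinPositive F (𝒜 n)) :
    ∃ k : ℕ → ℕ, StrictMono k ∧
      FinPositive F (⋃ n, {a ∈ 𝒜 n | ↑a ⊆ Ico (k n) (k (n + 1))}) := by
  obtain ⟨k, hk, hkF⟩ := h.exists_overlapping_intervals hcof h𝒜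
  by_cases heven : FinPositive F (⋃ n, {a ∈ 𝒜 n | ↑a ⊆ Ico (k (2 * n)) (k (2 * (n + 1)))})
  · exact ⟨fun n => k (2 * n), hk.comp fun m n hmn => by lia, heven⟩
  simp only [FinPositive, not_forall, not_exists, not_and] at heven
  obtain ⟨B, hB, hBno⟩ := heven
  refine ⟨fun n => k (2 * n + 1), hk.comp fun m n hmn => by lia, fun A hA => ?_⟩
  obtain ⟨i, hi⟩ := hkF _ (inter_mem hA hB)
  obtain ⟨j, rfl | rfl⟩ := i.even_or_odd'
  all_goals
    obtain ⟨a, ha, haAB⟩ := hi j (by lia)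
    obtain ⟨haA, haB⟩ := subset_inter_iff.1 (haAB.trans inter_subset_left)
    have haIco := haAB.trans inter_subset_right
  · exact absurd haB (hBno a (mem_iUnion.2 ⟨j, ha, haIco⟩))
  · exact ⟨a, mem_iUnion.2 ⟨j, ha, haIco⟩, haA⟩

theorem FinMenger.isStrongPPlus (hcof : F ≤ cofinite) (h : FinMenger F) : IsStrongPPlus F := by
  intro C hC
  obtain ⟨k, hk, hpos⟩ := h.exists_intervals hcof fun n =>
    finPositive_of_isCompact (hC n).1 (hC n).2
  refine ⟨k, hk, fun X hX => mem_positive_iff.2 fun A hA => ?_⟩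
  obtain ⟨a, ha, haA⟩ := hpos A hA
  obtain ⟨n, haC, haIco⟩ := mem_iUnion.1 ha
  obtain ⟨i, hi, hiX⟩ := haC (X n) (hX n)
  exact ⟨i, haA hi, mem_iUnion.2 ⟨n, hiX, haIco hi⟩⟩

theorem isStrongPPlus_iff_finMenger (hcof : F ≤ cofinite) : IsStrongPPlus F ↔ FinMenger F :=
  ⟨IsStrongPPlus.finMenger, FinMenger.isStrongPPlus hcof⟩

end StrongPPlus

section RealName

variable {P : Type*} [Preorder P] {x : RealName P} {n k l : ℕ} {p q : P}

theorem RealName.ForcesEq.mono (h : x.ForcesEq n k p) (hqp : q ≤ p) : x.ForcesEq n k q :=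
  fun r hr => h r (hr.trans hqp)

theorem RealName.forcesEq_of_mem_val (hp : p ∈ x.val n k) : x.ForcesEq n k p :=
  fun q hq => ⟨q, le_rfl, p, hp, hq⟩

theorem RealName.ForcesEq.unique (hk : x.ForcesEq n k p) (hl : x.ForcesEq n l p) : k = l := by
  obtain ⟨q, hq, c, hc, hqc⟩ := hk p le_rfl
  obtain ⟨r, hr, d, hd, hrd⟩ := hl q hq
  exact x.functional n k l c d hc hd ⟨r, hr.trans hqc, hrd⟩

theorem RealName.exists_forcesEq (x : RealName P) (n : ℕ) (p : P) :
    ∃ k, ∃ q ≤ p, x.ForcesEq n k q := by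
  obtain ⟨k, c, hc, q, hqp, hqc⟩ := x.total n p
  exact ⟨k, q, hqp, (forcesEq_of_mem_val hc).mono hqc⟩

end RealName

namespace Mathias

variable {F : Filter ℕ} {p q : Mathias F}

theorem mem_side_of_le (h : p ≤ q) {i : ℕ} (hi : i ∈ p.stem) (hiq : i ∉ q.stem) : i ∈ q.side :=
  h.2.2 (by simp [hi, hiq])

theorem le_of_subset (hside : p.side ⊆ q.side) (hstem : q.stem ⊆ p.stem)
    (hdiff : ∀ i ∈ p.stem, i ∉ q.stem → i ∈ q.side) : p ≤ q := by
  have hmem : ∀ i ∈ p.stem \ q.stem, i ∈ q.side := fun i hi =>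
    hdiff i (Finset.mem_sdiff.1 hi).1 (Finset.mem_sdiff.1 hi).2
  exact ⟨hside, ⟨hstem, fun i hi j hj => q.stem_lt_side i hi j (hmem j hj)⟩, hmem⟩

/-- The condition obtained from `p` by shrinking its side to the part in `A`. -/
def restrict (p : Mathias F) {A : Set ℕ} (hA : A ∈ F) : Mathias F where
  stem := p.stem
  side := p.side ∩ A
  side_mem := inter_mem p.side_mem hA
  stem_lt_side i hi j hj := p.stem_lt_side i hi j hj.1

theorem restrict_le (p : Mathias F) {A : Set ℕ} (hA : A ∈ F) : p.restrict hA ≤ p :=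
  le_of_subset inter_subset_left Finset.Subset.rfl fun _ hi hip => absurd hi hip

/-- The condition with stem `s` and side the part of `A` above `s`. -/
def ofStem (hcof : F ≤ cofinite) (s : Finset ℕ) {A : Set ℕ} (hA : A ∈ F) : Mathias F where
  stem := s
  side := {j ∈ A | ∀ i ∈ s, i < j}
  side_mem := inter_mem hA <| (eventually_all_finset s).2 fun i _ =>
    Ici_mem_of_le_cofinite hcof (i + 1)
  stem_lt_side i hi _ hj := hj.2 i hi

/-- The part of `s` in the interval `[n, k)` contains a member of `𝒜`. -/
def Captures (𝒜 : Set (Finset ℕ)) (s : Finset ℕ) (n k : ℕ) : Prop :=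
  ∃ a ∈ 𝒜, a ⊆ s ∩ Finset.Ico n k

theorem Captures.mono {𝒜 : Set (Finset ℕ)} {s t : Finset ℕ} {n k : ℕ}
    (h : Captures 𝒜 s n k) (hst : ∀ i < k, i ∈ s → i ∈ t) : Captures 𝒜 t n k := by
  obtain ⟨a, ha, has⟩ := h
  refine ⟨a, ha, fun i hi => ?_⟩
  obtain ⟨his, hik⟩ := Finset.mem_inter.1 (has hi)
  exact Finset.mem_inter.2 ⟨hst i (Finset.mem_Ico.1 hik).2 his, hik⟩

/-- The conditions deciding that `k` is least such that the part of the generic real in `[n, k)`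
contains a member of `𝒜 n`. -/
def captureVal (F : Filter ℕ) (𝒜 : ℕ → Set (Finset ℕ)) (n k : ℕ) : Set (Mathias F) :=
  {p | p.side ⊆ Ici k ∧ IsLeast {l | Captures (𝒜 n) p.stem n l} k}

theorem isLeast_of_le_of_mem_captureVal {𝒜 : ℕ → Set (Finset ℕ)} {n k : ℕ}
    (hp : p ∈ captureVal F 𝒜 n k) (hqp : q ≤ p) :
    IsLeast {l | Captures (𝒜 n) q.stem n l} k := by
  obtain ⟨hside, hk, hleast⟩ := hp
  refine ⟨hk.mono fun i _ hi => hqp.2.1.1 hi, fun l hl => not_lt.1 fun hlk => ?_⟩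
  refine hlk.not_ge (hleast (hl.mono fun i hil hi => by_contra fun hip => ?_))
  exact (hil.trans hlk).not_ge (hside (mem_side_of_le hqp hi hip))

theorem exists_le_mem_captureVal (hcof : F ≤ cofinite) {𝒜 : ℕ → Set (Finset ℕ)}
    (h𝒜 : ∀ n, FinPositive F (𝒜 n)) (n : ℕ) (p : Mathias F) :
    ∃ k, ∃ q ≤ p, q ∈ captureVal F 𝒜 n k := by
  classical
  obtain ⟨a, ⟨ha, hna⟩, hap⟩ :=
    (h𝒜 n).sep_subset (Ici_mem_of_le_cofinite hcof n) _ p.side_mem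
  obtain ⟨l, hl⟩ := a.exists_nat_subset_range
  have hcaptures : ∃ k, Captures (𝒜 n) (p.stem ∪ a) n k := ⟨l, a, ha, fun i hi =>
    Finset.mem_inter.2 ⟨Finset.mem_union_right _ hi,
      Finset.mem_Ico.2 ⟨hna hi, Finset.mem_range.1 (hl hi)⟩⟩⟩
  refine ⟨Nat.find hcaptures, ofStem hcof (p.stem ∪ a)
    (inter_mem p.side_mem (Ici_mem_of_le_cofinite hcof (Nat.find hcaptures))),
    le_of_subset (fun j hj => hj.1.1) Finset.subset_union_left fun i hi hip => ?_,
    fun j hj => hj.1.2, Nat.isLeast_find hcaptures⟩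
  exact hap ((Finset.mem_union.1 hi).resolve_left hip)

/-- The name for the function sending `n` to the least `k` such that the part of the generic
real in `[n, k)` contains a member of `𝒜 n`. -/
def captureName (hcof : F ≤ cofinite) {𝒜 : ℕ → Set (Finset ℕ)}
    (h𝒜 : ∀ n, FinPositive F (𝒜 n)) : RealName (Mathias F) where
  val := captureVal F 𝒜
  functional := by
    rintro n k l p q hp hq ⟨r, hrp, hrq⟩
    exact (isLeast_of_le_of_mem_captureVal hp hrp).unique
      (isLeast_of_le_of_mem_captureVal hq hrq)
  total n p := by
    obtain ⟨k, q, hqp, hq⟩ := exists_le_mem_captureVal hcof h𝒜 n p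
    exact ⟨k, q, hq, q, hqp, le_rfl⟩

/-- Shrink the side of a condition to some `A ∈ F` containing no `a ∈ 𝒜 n` with `a ⊆ [0, f n)`.
From then on, a member of `𝒜 n` captured from beyond the old stem reaches past `f n`. -/
theorem captureName_forcesDominates (hcof : F ≤ cofinite) {𝒜 : ℕ → Set (Finset ℕ)}
    (h𝒜 : ∀ n, FinPositive F (𝒜 n)) {f : ℕ → ℕ}
    (hf : ¬ FinPositive F (⋃ n, {a ∈ 𝒜 n | a ⊆ Finset.range (f n)})) (p : Mathias F) :
    (captureName hcof h𝒜).ForcesDominates f p := by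
  simp only [FinPositive, not_forall, not_exists, not_and] at hf
  obtain ⟨A, hA, hAno⟩ := hf
  intro q _
  obtain ⟨m, hm⟩ := q.stem.exists_nat_subset_range
  refine ⟨q.restrict hA, q.restrict_le hA, m, mem_univ m, fun n hmn r hr => ?_⟩
  obtain ⟨k, u, hur, hu⟩ := exists_le_mem_captureVal hcof h𝒜 n r
  refine ⟨u, hur, k, show f n ≤ k from not_lt.1 fun hkf => ?_, RealName.forcesEq_of_mem_val hu⟩
  obtain ⟨a, ha, hau⟩ := hu.2.1
  have hak : a ⊆ Finset.Ico n k := hau.trans Finset.inter_subset_right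
  refine hAno a (mem_iUnion.2 ⟨n, ha, fun i hi => Finset.mem_range.2 ?_⟩) fun i hi => ?_
  · exact (Finset.mem_Ico.1 (hak hi)).2.trans hkf
  · refine (mem_side_of_le (hur.trans hr) (Finset.mem_inter.1 (hau hi)).1 fun hiq => ?_).2
    have him : i < m := Finset.mem_range.1 (hm hiq)
    exact him.not_ge (hmn.le.trans (Finset.mem_Ico.1 (hak hi)).1)

theorem finMenger_of_addsNoDominatingReal (hcof : F ≤ cofinite)
    (h : AddsNoDominatingReal (Mathias F)) : FinMenger F := by
  classical
  intro 𝒜 h𝒜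
  have hdom := h (captureName hcof h𝒜) (ofStem hcof ∅ univ_mem)
  simp only [RealName.ForcesDominating, not_forall] at hdom
  obtain ⟨f, hf⟩ := hdom
  refine ⟨fun n => {a ∈ (Finset.range (f n)).powerset | a ∈ 𝒜 n}, fun n a ha =>
    (Finset.mem_filter.1 ha).2, ?_⟩
  have hpos := not_not.1 (mt (captureName_forcesDominates hcof h𝒜 · _) hf)
  simpa [and_comm] using hpos

/-- Some condition with stem `s ∪ t` forces `x(n) = k`. -/
def Decides (x : RealName (Mathias F)) (n : ℕ) (s t : Finset ℕ) (k : ℕ) : Prop :=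
  ∃ q : Mathias F, q.stem = s ∪ t ∧ x.ForcesEq n k q

theorem finPositive_setOf_decides (hcof : F ≤ cofinite) (x : RealName (Mathias F)) (n : ℕ)
    (s : Finset ℕ) : FinPositive F {t | ∃ k, Decides x n s t k} := by
  intro A hA
  obtain ⟨k, q, hq, hk⟩ := x.exists_forcesEq n (ofStem hcof s hA)
  refine ⟨q.stem \ s, ⟨k, q, (Finset.union_sdiff_of_subset hq.2.1.1).symm, hk⟩, fun i hi => ?_⟩
  exact (hq.2.2 hi).1

theorem Decides.exists_le {x : RealName (Mathias F)} {n k : ℕ} {t : Finset ℕ}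
    (h : Decides x n p.stem t k) (ht : (t : Set ℕ) ⊆ p.side) :
    ∃ q ≤ p, x.ForcesEq n k q := by
  obtain ⟨q, hstem, hk⟩ := h
  refine ⟨q.restrict p.side_mem, le_of_subset inter_subset_right
    (hstem.symm.subset.trans' Finset.subset_union_left) fun i hi hip => ?_,
    hk.mono (q.restrict_le _)⟩
  exact ht ((Finset.mem_union.1 (hstem.subset hi)).resolve_left hip)

theorem addsNoDominatingReal_of_finMenger (hcof : F ≤ cofinite) (h : FinMenger F) :
    AddsNoDominatingReal (Mathias F) := by
  intro x p hdom
  obtain ⟨ℬ, hℬ, hpos⟩ := h.exists_forall_tail monotone_finPositive fun n =>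
    FinPositive.forall_exists_subset (Finset.range n).powerset fun s _ =>
      finPositive_setOf_decides hcof x n s
  have hbound (n) : ∃ N, ∀ b ∈ ℬ n, ∀ s ∈ (Finset.range n).powerset,
      ∃ k < N, ∃ t ⊆ b, Decides x n s t k := by
    refine Eventually.exists (f := atTop) ?_
    simp only [eventually_all_finset]
    intro b hb s hs
    obtain ⟨t, ⟨k, hk⟩, htb⟩ := hℬ n hb s hs
    filter_upwards [eventually_gt_atTop k] with N hN using ⟨k, hN, t, htb, hk⟩
  choose f hf using hbound
  obtain ⟨r, -, m, -, hr⟩ := hdom f p le_rfl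
  obtain ⟨N, hN⟩ := r.stem.exists_nat_subset_range
  obtain ⟨b, hb, hbr⟩ := hpos (max m N) r.side r.side_mem
  obtain ⟨n, hn, hb⟩ := mem_iUnion₂.1 hb
  have hrn : r.stem ∈ (Finset.range n).powerset := Finset.mem_powerset.2
    (hN.trans (Finset.range_mono ((le_max_right m N).trans hn)))
  obtain ⟨k, hkf, t, htb, hk⟩ := hf n b hb r.stem hrn
  obtain ⟨u, hur, hu⟩ := hk.exists_le ((Finset.coe_subset.2 htb).trans hbr)
  obtain ⟨w, hwu, l, hfl, hw⟩ := hr n ((le_max_left m N).trans hn) u hur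
  have hlk : l = k := hw.unique (hu.mono hwu)
  exact hkf.not_ge (hlk ▸ hfl)

theorem addsNoDominatingReal_iff_finMenger (hcof : F ≤ cofinite) :
    AddsNoDominatingReal (Mathias F) ↔ FinMenger F :=
  ⟨finMenger_of_addsNoDominatingReal hcof, addsNoDominatingReal_of_finMenger hcof⟩

end Mathias

end FilterForcing

theorem theorem3p5 (F : Filter ℕ) (hne : F.NeBot) (hcof : F ≤ Filter.cofinite)
    (e : FilterForcing.NeFin ≃ ℕ) :
    List.TFAE
      [FilterForcing.AddsNoDominatingReal (FilterForcing.Mathias F),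
       FilterForcing.IsMenger F,
       FilterForcing.IsMenger (FilterForcing.finPow F),
       FilterForcing.IsPPlus (FilterForcing.finPow F),
       FilterForcing.IsStrongPPlus F,
       FilterForcing.IsStrongPPlus ((FilterForcing.finPow F).map e)] := by
  open FilterForcing in
  rw [Mathias.addsNoDominatingReal_iff_finMenger hcof, isMenger_iff_finMenger,
    isMenger_iff_finMenger, isPPlus_finPow_iff_finMenger hcof,
    isStrongPPlus_iff_finMenger hcof, isStrongPPlus_iff_finMenger (map_finPow_le_cofinite hcof e),
    finMenger_map_equiv, finMenger_finPow]
  exact List.tfae_of_forall (FilterForcing.FinMenger F) _ (by simp)
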